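/- Let $SL_\circ(2,\mathbb R)$ denote the identity component of the group $SL(2,\mathbb R)$ of real $2\times 2$ matrices of determinant $1$, let $\widetilde{SL}_\circ(2,\mathbb R)$ be its universal covering group, and let $ST_\circ(2,\mathbb R)$ denote the identity component of the subgroup $ST(2,\mathbb R)\subset SL(2,\mathbb R)$ of upper triangular matrices. An action of a topological group $G$ on a space $M$ is a homomorphism $g\mapsto g^\alpha$ from $G$ to the group of homeomorphisms of $M$ such that the evaluation map $G\times M\to M$, $(g,x)\mapsto g^\alpha(x)$, is continuous; it is effective if its kernel is trivial. Theorem. Let $j,k,m\ge 0$ be integers. Then the topological group $$\widetilde{SL}_\circ(2,\mathbb R)^j\times ST_\circ(2,\mathbb R)^k\times\mathbb R^m$$ has an effective action on every nonempty (Hausdorff, finite-dimensional, real) topological manifold $M$ of positive dimension, possibly with boundary or corners. In particular it acts effectively on every connected analytic manifold of positive dimension, with or without boundary. -/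

import Mathlib

open scoped unitInterval MatrixGroups Manifold

instance continuousMap_isTopologicalGroup (X G : Type*) [TopologicalSpace X]
    [LocallyCompactSpace X] [TopologicalSpace G] [Group G] [IsTopologicalGroup G] : IsTopologicalGroup C(X, G) where
  continuous_mul := continuous_mul
  continuous_inv := ContinuousMap.continuous_postcomp (⟨fun q => q⁻¹, by fun_prop⟩ : C(G, G))

/-- The group, under pointwise multiplication, of continuous paths `[0,1] → G` that start at `1`,
with the compact-open topology. -/
def basedPathGroup (G : Type*) [TopologicalSpace G] [Group G] [IsTopologicalGroup G] :
    Subgroup C(I, G) where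
  carrier := {f | f 0 = 1}
  one_mem' := rfl
  mul_mem' {f g} hf hg := by
    simp only [Set.mem_ofPred_eq] at hf hg ⊢
    simp [hf, hg]
  inv_mem' {f} hf := by
    simp only [Set.mem_ofPred_eq] at hf ⊢
    simp [hf]

/-- The subgroup of those paths starting at `1` that are loops, contractible relative to their
endpoints. -/
def nullhomotopicLoops (G : Type*) [TopologicalSpace G] [Group G] [IsTopologicalGroup G] :
    Subgroup (basedPathGroup G) where
  carrier := {f | (f : C(I, G)).HomotopicRel 1 {0, 1}}
  one_mem' := ContinuousMap.HomotopicRel.refl _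
  mul_mem' {f g} hf hg := by
    obtain ⟨F⟩ := hf
    obtain ⟨K⟩ := hg
    exact ⟨{ toFun := fun p => F p * K p
             map_zero_left := fun x => by simp
             map_one_left := fun x => by simp
             prop' := fun t x hx => by
               have h1 := F.eq_fst t hx
               have h2 := K.eq_fst t hx
               simp only [ContinuousMap.coe_mk, Subgroup.coe_mul, ContinuousMap.mul_apply]
               rw [h1, h2] }⟩
  inv_mem' {f} hf := by
    obtain ⟨F⟩ := hf
    exact ⟨{ toFun := fun p => (F p)⁻¹
             map_zero_left := fun x => by simp
             map_one_left := fun x => by simp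
             prop' := fun t x hx => by
               have h1 := F.eq_fst t hx
               simp only [ContinuousMap.coe_mk, Subgroup.coe_inv, ContinuousMap.inv_apply]
               rw [h1] }⟩

instance nullhomotopicLoops_normal (G : Type*) [TopologicalSpace G] [Group G]
    [IsTopologicalGroup G] : (nullhomotopicLoops G).Normal where
  conj_mem f hf g := by
    obtain ⟨F⟩ := hf
    exact ⟨{ toFun := fun p => (g : C(I, G)) p.2 * F p * ((g : C(I, G)) p.2)⁻¹
             map_zero_left := fun x => by simp
             map_one_left := fun x => by simp
             prop' := fun t x hx => by
               have h1 := F.eq_fst t hx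
               simp only [ContinuousMap.coe_mk, Subgroup.coe_mul, Subgroup.coe_inv,
                 ContinuousMap.mul_apply, ContinuousMap.inv_apply]
               rw [h1] }⟩

/-- The universal covering group of a connected Lie group `G`: homotopy classes, relative to the
endpoints, of paths starting at `1`, multiplied pointwise, with the quotient of the compact-open
topology. (Two such paths `f`, `g` are homotopic relative to their endpoints exactly when `f⁻¹ * g`
is a contractible loop; the covering map sends the class of a path to its endpoint.) -/
abbrev UniversalCoveringGroup (G : Type*) [TopologicalSpace G] [Group G] [IsTopologicalGroup G] :
    Type _ :=
  basedPathGroup G ⧸ nullhomotopicLoops G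

/-- `SL∘(n, ℝ)`, the identity component of `SL(n, ℝ)`. -/
abbrev SLo (n : ℕ) : Subgroup SL(n, ℝ) :=
  Subgroup.connectedComponentOfOne SL(n, ℝ)

/-- `ST(n, ℝ)`, the upper triangular matrices in `SL(n, ℝ)`. -/
def upperTriangularSL (n : ℕ) : Subgroup SL(n, ℝ) where
  carrier := {g | (g : Matrix (Fin n) (Fin n) ℝ).BlockTriangular id}
  one_mem' := by
    simpa using Matrix.blockTriangular_one
  mul_mem' {f g} hf hg := by
    simpa using Matrix.BlockTriangular.mul hf hg
  inv_mem' {g} hg := by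
    have h : ((g⁻¹ : SL(n, ℝ)) : Matrix (Fin n) (Fin n) ℝ) =
        (g : Matrix (Fin n) (Fin n) ℝ)⁻¹ := by
      rw [Matrix.inv_def]
      simp [Matrix.SpecialLinearGroup.coe_inv]
    have : Invertible (g : Matrix (Fin n) (Fin n) ℝ) :=
      Matrix.invertibleOfIsUnitDet _ (by simp)
    simp only [Set.mem_ofPred_eq] at hg ⊢
    rw [h]
    exact Matrix.blockTriangular_inv_of_blockTriangular hg

/-- `ST∘(n, ℝ)`, the identity component of `ST(n, ℝ)`. -/
abbrev STo (n : ℕ) : Subgroup (upperTriangularSL n) :=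
  Subgroup.connectedComponentOfOne (upperTriangularSL n)

/-- An action of the topological group `G` on the space `M`: a homomorphism from `G` to the group
of homeomorphisms of `M` whose evaluation map `G × M → M` is continuous. -/
structure ContinuousAction (G M : Type*) [TopologicalSpace G] [Group G] [TopologicalSpace M] where
  /-- the homomorphism -/
  toHom : G →* (M ≃ₜ M)
  continuous_eval : Continuous fun p : G × M => toHom p.1 p.2

/-- An action is effective if its kernel is trivial. -/
def ContinuousAction.Effective {G M : Type*} [TopologicalSpace G] [Group G] [TopologicalSpace M]
    (α : ContinuousAction G M) : Prop :=
  α.toHom.ker = ⊥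

/-!
Everything is reduced to the real line. A group acts *on the line* here if it acts faithfully by
increasing bijections of `ℝ` with continuous orbit maps; monotonicity makes such an action jointly
continuous (`continuous_uncurry_orderIso`).

An action on the line can be squeezed into the bounded interval `(-1, 1)`, or its translate
`(1, 3)`, and extended by the identity. The extension is again increasing with continuous orbit
maps. Letting two groups act on these two disjoint intervals shows that the class of groups acting
on the line is closed under finite products (`ActsOnLine.prod`, `ActsOnLine.pi`).

Every factor acts on the line: `ℝ` by translations, the triangular group by affine maps
(`actsOnLine_STo`), and the universal covering group by lifting the action of `SL(2, ℝ)` on the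
circle of rays in the plane (`actsOnLine_universalCoveringGroup_SLo`). The lift is obtained from a
path of matrices by following the angle of a moving ray, through homotopy lifting for the covering
`exp : ℂ → ℂ \ {0}`. If a path acts trivially, it is a loop along which the first column has winding
number zero; since a matrix of determinant `1` amounts to its first column and a real shear
coefficient, such a loop is contractible, so the action is faithful.

Finally, an action on the line supported in `(1, 3)` acts on a normed space by changing the norms of
vectors, with compact support, and a manifold of positive dimension contains an open copy of its
model vector space, whether or not it has boundary or corners. Extension by the identity gives the
action on the manifold (`ActsOnLine.exists_effective_continuousAction_manifold`).
-/

/-! ### Faithful actions on the real line -/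

/-- `G` acts faithfully on the real line by increasing bijections, with continuous orbit maps.
For increasing bijections this already forces the evaluation map `G × ℝ → ℝ` to be continuous. -/
def ActsOnLine (G : Type*) [TopologicalSpace G] [Group G] : Prop :=
  ∃ φ : G →* (ℝ ≃o ℝ), Function.Injective φ ∧ ∀ x, Continuous fun g => φ g x

/-- Orbit maps of an order-preserving action are jointly continuous: near a point `x`, the images
are squeezed between those of two fixed points on either side of `x`. -/
theorem continuous_uncurry_orderIso {G : Type*} [TopologicalSpace G] {φ : G → (ℝ ≃o ℝ)}
    (hφ : ∀ x, Continuous fun g => φ g x) : Continuous fun p : G × ℝ => φ p.1 p.2 := by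
  rw [continuous_iff_continuousAt]
  rintro ⟨g, x⟩
  rw [ContinuousAt, tendsto_order]
  constructor
  · intro a ha
    obtain ⟨y, hy, hyx⟩ : ∃ y, a < φ g y ∧ y < x := by
      obtain ⟨b, hab, hb⟩ := exists_between ha
      exact ⟨(φ g).symm b, by simpa using hab, by simpa [OrderIso.symm_apply_lt] using hb⟩
    filter_upwards [prod_mem_nhds ((hφ y).continuousAt.eventually (lt_mem_nhds hy))
      (lt_mem_nhds hyx)] with p hp
    exact lt_trans hp.1 ((φ p.1).strictMono hp.2)
  · intro a ha
    obtain ⟨y, hy, hyx⟩ : ∃ y, φ g y < a ∧ x < y := by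
      obtain ⟨b, hb, hab⟩ := exists_between ha
      exact ⟨(φ g).symm b, by simpa using hab, by simpa [OrderIso.lt_symm_apply] using hb⟩
    filter_upwards [prod_mem_nhds ((hφ y).continuousAt.eventually (gt_mem_nhds hy))
      (gt_mem_nhds hyx)] with p hp
    exact lt_trans ((φ p.1).strictMono hp.2) hp.1

theorem ActsOnLine.of_injective {G G' : Type*} [TopologicalSpace G] [Group G]
    [TopologicalSpace G'] [Group G'] (h : ActsOnLine G') (f : G →* G') (hf : Continuous f)
    (hinj : Function.Injective f) : ActsOnLine G := by
  obtain ⟨φ, hφ, hc⟩ := h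
  exact ⟨φ.comp f, hφ.comp hinj, fun x => (hc x).comp hf⟩

theorem ActsOnLine.of_subsingleton (G : Type*) [TopologicalSpace G] [Group G] [Subsingleton G] :
    ActsOnLine G :=
  ⟨1, Function.injective_of_subsingleton _, fun x => by simpa using continuous_const⟩

/-- A bijection of the line carried to `(-1, 1)` and extended by the identity. -/
noncomputable def squeezeFun (f : ℝ ≃o ℝ) (x : ℝ) : ℝ :=
  if h : x ∈ Set.Ioo (-1 : ℝ) 1 then
    orderIsoIooNegOneOne ℝ (f ((orderIsoIooNegOneOne ℝ).symm ⟨x, h⟩))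
  else x

theorem squeezeFun_coe (f : ℝ ≃o ℝ) (y : ℝ) :
    squeezeFun f (orderIsoIooNegOneOne ℝ y) = orderIsoIooNegOneOne ℝ (f y) := by
  rw [squeezeFun, dif_pos (orderIsoIooNegOneOne ℝ y).2]
  simp

theorem squeezeFun_of_notMem (f : ℝ ≃o ℝ) {x : ℝ} (hx : x ∉ Set.Ioo (-1 : ℝ) 1) :
    squeezeFun f x = x := dif_neg hx

theorem exists_orderIsoIoo_eq {x : ℝ} (hx : x ∈ Set.Ioo (-1 : ℝ) 1) :
    ∃ y, (orderIsoIooNegOneOne ℝ y : ℝ) = x :=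
  ⟨(orderIsoIooNegOneOne ℝ).symm ⟨x, hx⟩, by simp⟩

theorem squeezeFun_mul (f g : ℝ ≃o ℝ) (x : ℝ) :
    squeezeFun (f * g) x = squeezeFun f (squeezeFun g x) := by
  by_cases hx : x ∈ Set.Ioo (-1 : ℝ) 1
  · obtain ⟨y, rfl⟩ := exists_orderIsoIoo_eq hx
    simp only [squeezeFun_coe, RelIso.mul_apply]
  · simp only [squeezeFun_of_notMem _ hx]

theorem squeezeFun_one (x : ℝ) : squeezeFun 1 x = x := by
  by_cases hx : x ∈ Set.Ioo (-1 : ℝ) 1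
  · obtain ⟨y, rfl⟩ := exists_orderIsoIoo_eq hx
    simp only [squeezeFun_coe, RelIso.one_apply]
  · exact squeezeFun_of_notMem _ hx

theorem squeezeFun_strictMono (f : ℝ ≃o ℝ) : StrictMono (squeezeFun f) := by
  intro x y hxy
  by_cases hx : x ∈ Set.Ioo (-1 : ℝ) 1 <;> by_cases hy : y ∈ Set.Ioo (-1 : ℝ) 1
  · obtain ⟨a, rfl⟩ := exists_orderIsoIoo_eq hx
    obtain ⟨b, rfl⟩ := exists_orderIsoIoo_eq hy
    simp only [squeezeFun_coe, Subtype.coe_lt_coe, OrderIso.lt_iff_lt] at hxy ⊢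
    exact hxy
  · obtain ⟨a, rfl⟩ := exists_orderIsoIoo_eq hx
    rw [squeezeFun_coe, squeezeFun_of_notMem f hy]
    have h := (orderIsoIooNegOneOne ℝ (f a)).2
    simp only [Set.mem_Ioo, not_and, not_lt] at hx hy h
    exact h.2.trans_le (hy (by linarith))
  · obtain ⟨b, rfl⟩ := exists_orderIsoIoo_eq hy
    rw [squeezeFun_coe, squeezeFun_of_notMem f hx]
    have h := (orderIsoIooNegOneOne ℝ (f b)).2
    simp only [Set.mem_Ioo, not_and_or, not_lt] at hx hy h
    rcases hx with hx | hx <;> linarith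
  · rwa [squeezeFun_of_notMem f hx, squeezeFun_of_notMem f hy]

/-- The homomorphism making a bijection of the line act on `(-1, 1)`, by the identity elsewhere. -/
noncomputable def squeeze : (ℝ ≃o ℝ) →* (ℝ ≃o ℝ) where
  toFun f :=
    { toFun := squeezeFun f
      invFun := squeezeFun f⁻¹
      left_inv := fun x => by rw [← squeezeFun_mul, inv_mul_cancel, squeezeFun_one]
      right_inv := fun x => by rw [← squeezeFun_mul, mul_inv_cancel, squeezeFun_one]
      map_rel_iff' := (squeezeFun_strictMono f).le_iff_le }
  map_one' := RelIso.ext squeezeFun_one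
  map_mul' f g := RelIso.ext (squeezeFun_mul f g)

theorem squeeze_apply (f : ℝ ≃o ℝ) (x : ℝ) : squeeze f x = squeezeFun f x := rfl

theorem squeeze_injective : Function.Injective squeeze := by
  intro f g h
  ext y
  have := congrArg (fun e : ℝ ≃o ℝ => e (orderIsoIooNegOneOne ℝ y)) h
  simpa only [squeeze_apply, squeezeFun_coe, Subtype.coe_inj, EmbeddingLike.apply_eq_iff_eq]
    using this

theorem continuous_squeeze_apply {G : Type*} [TopologicalSpace G] {φ : G → (ℝ ≃o ℝ)}
    (hφ : ∀ x, Continuous fun g => φ g x) (x : ℝ) : Continuous fun g => squeeze (φ g) x := by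
  simp only [squeeze_apply]
  by_cases hx : x ∈ Set.Ioo (-1 : ℝ) 1
  · obtain ⟨y, rfl⟩ := exists_orderIsoIoo_eq hx
    simp only [squeezeFun_coe]
    exact continuous_subtype_val.comp ((orderIsoIooNegOneOne ℝ).continuous.comp (hφ y))
  · simpa only [squeezeFun_of_notMem _ hx] using continuous_const

/-- The translation by `2`, which moves the interval `(-1, 1)` off itself to `(1, 3)`. -/
noncomputable abbrev shiftTwo : ℝ ≃o ℝ := OrderIso.addRight 2

/-- The homomorphism making a bijection of the line act on `(1, 3)`, by the identity elsewhere. -/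
noncomputable def shiftedSqueeze : (ℝ ≃o ℝ) →* (ℝ ≃o ℝ) :=
  (MulAut.conj shiftTwo).toMonoidHom.comp squeeze

theorem shiftedSqueeze_apply (f : ℝ ≃o ℝ) (x : ℝ) :
    shiftedSqueeze f x = squeezeFun f (x - 2) + 2 := rfl

theorem shiftedSqueeze_injective : Function.Injective shiftedSqueeze :=
  (MulAut.conj shiftTwo).injective.comp squeeze_injective

theorem continuous_shiftedSqueeze_apply {G : Type*} [TopologicalSpace G] {φ : G → (ℝ ≃o ℝ)}
    (hφ : ∀ x, Continuous fun g => φ g x) (x : ℝ) :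
    Continuous fun g => shiftedSqueeze (φ g) x :=
  (continuous_squeeze_apply hφ (x - 2)).add_const 2

theorem shiftedSqueeze_of_notMem (f : ℝ ≃o ℝ) {x : ℝ} (hx : x ∉ Set.Ioo (1 : ℝ) 3) :
    shiftedSqueeze f x = x := by
  rw [shiftedSqueeze_apply, squeezeFun_of_notMem, sub_add_cancel]
  rintro ⟨h1, h2⟩
  exact hx ⟨by linarith, by linarith⟩

theorem squeeze_commute_shiftedSqueeze (f g : ℝ ≃o ℝ) :
    Commute (squeeze f) (shiftedSqueeze g) := by
  have h : Equiv.Perm.Disjoint (squeeze f).toEquiv (shiftedSqueeze g).toEquiv := by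
    intro x
    by_cases hx : x ∈ Set.Ioo (-1 : ℝ) 1
    · exact Or.inr (shiftedSqueeze_of_notMem g fun h => by linarith [hx.2, h.1])
    · exact Or.inl (squeezeFun_of_notMem f hx)
  ext x
  exact congrArg (fun e : Equiv.Perm ℝ => e x) h.commute.eq

/-- Two groups acting on the line act simultaneously, on disjoint intervals. -/
theorem ActsOnLine.prod {G G' : Type*} [TopologicalSpace G] [Group G] [TopologicalSpace G']
    [Group G'] (h : ActsOnLine G) (h' : ActsOnLine G') : ActsOnLine (G × G') := by
  obtain ⟨φ, hφ, hc⟩ := h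
  obtain ⟨ψ, hψ, hd⟩ := h'
  refine ⟨MonoidHom.noncommCoprod (squeeze.comp φ) (shiftedSqueeze.comp ψ)
    fun g g' => squeeze_commute_shiftedSqueeze _ _, ?_, fun x => ?_⟩
  · rw [injective_iff_map_eq_one]
    rintro ⟨g, g'⟩ hg
    have hg : squeeze (φ g) * shiftedSqueeze (ψ g') = 1 := hg
    -- The second factor is trivial: off `(1, 3)` always, and on `(1, 3)` because the first one is.
    have h2 : shiftedSqueeze (ψ g') = 1 := by
      ext x
      by_cases hx : x ∈ Set.Ioo (1 : ℝ) 3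
      · have hx' : squeeze (φ g) x = x :=
          squeezeFun_of_notMem _ fun h => by linarith [hx.1, h.2]
        rw [(squeeze_commute_shiftedSqueeze _ _).eq] at hg
        have := congrArg (fun e : ℝ ≃o ℝ => e x) hg
        simpa only [RelIso.mul_apply, hx'] using this
      · exact shiftedSqueeze_of_notMem _ hx
    rw [h2, mul_one] at hg
    exact Prod.ext (hφ (squeeze_injective (by simpa using hg)))
      (hψ (shiftedSqueeze_injective (by simpa using h2)))
  · exact (continuous_uncurry_orderIso (continuous_squeeze_apply hc)).comp
      (continuous_fst.prodMk ((continuous_shiftedSqueeze_apply hd x).comp continuous_snd))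

theorem ActsOnLine.pi {G : Type*} [TopologicalSpace G] [Group G] (h : ActsOnLine G) (n : ℕ) :
    ActsOnLine (Fin n → G) := by
  induction n with
  | zero => exact .of_subsingleton _
  | succ n ih =>
    refine (h.prod ih).of_injective
      { toFun := fun a => (a 0, fun i => a i.succ)
        map_one' := rfl
        map_mul' := fun _ _ => rfl } (by simp only [MonoidHom.coe_mk, OneHom.coe_mk]; fun_prop) ?_
    intro a b hab
    simp only [MonoidHom.coe_mk, OneHom.coe_mk, Prod.mk.injEq] at hab
    ext i
    exact Fin.cases hab.1 (congrFun hab.2) i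

/-! ### The real line and the triangular group -/

theorem actsOnLine_multiplicative_real : ActsOnLine (Multiplicative ℝ) := by
  refine ⟨{ toFun := fun a => OrderIso.addRight a.toAdd
            map_one' := by ext; simp
            map_mul' := fun a b => by
              ext x
              simp only [toAdd_mul, OrderIso.addRight_apply, RelIso.mul_apply]
              ring }, ?_, ?_⟩
  · intro a b hab
    have := congrArg (fun e : ℝ ≃o ℝ => e 0) hab
    simpa using this
  · intro x
    exact continuous_const.add continuous_toAdd

theorem actsOnLine_multiplicative_pi (m : ℕ) : ActsOnLine (Multiplicative (Fin m → ℝ)) :=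
  (actsOnLine_multiplicative_real.pi m).of_injective
    { toFun := fun a i => Multiplicative.ofAdd (a.toAdd i)
      map_one' := rfl
      map_mul' := fun _ _ => rfl }
    (continuous_pi fun i => continuous_ofAdd.comp ((continuous_apply i).comp continuous_toAdd))
    fun _ _ h => Multiplicative.toAdd.injective
      (funext fun i => Multiplicative.ofAdd.injective (congrFun h i))

theorem upperTriangularSL_apply_one_zero (g : upperTriangularSL 2) : (g : SL(2, ℝ)) 1 0 = 0 :=
  g.2 (by decide : id (0 : Fin 2) < id 1)

theorem upperTriangularSL_apply_mul (g : upperTriangularSL 2) :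
    (g : SL(2, ℝ)) 0 0 * (g : SL(2, ℝ)) 1 1 = 1 := by
  have h := (g : SL(2, ℝ)).det_coe
  rw [Matrix.det_fin_two] at h
  have h0 := upperTriangularSL_apply_one_zero g
  simpa [h0] using h

theorem continuous_upperTriangularSL_apply (i j : Fin 2) :
    Continuous fun g : upperTriangularSL 2 => (g : SL(2, ℝ)) i j := by
  have : Continuous fun g : upperTriangularSL 2 => (g : SL(2, ℝ)) i :=
    Matrix.SpecialLinearGroup.continuous_apply _ continuous_subtype_val i
  exact (continuous_apply j).comp this

theorem STo_apply_zero_zero_pos (g : STo 2) : 0 < ((g : upperTriangularSL 2) : SL(2, ℝ)) 0 0 := by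
  by_contra! h
  have hpre : IsPreconnected (connectedComponent (1 : upperTriangularSL 2)) :=
    isPreconnected_connectedComponent
  obtain ⟨a, -, ha⟩ := hpre.intermediate_value g.2 mem_connectedComponent
    (continuous_upperTriangularSL_apply 0 0).continuousOn ⟨h, by simp⟩
  have := upperTriangularSL_apply_mul a
  simp only at ha
  rw [ha] at this
  simp at this

/-- The matrix `!![a, b; 0, a⁻¹]` acts on the projective line fixing the point at infinity, that is
by the affine map `x ↦ a² x + a b`. -/
theorem actsOnLine_STo : ActsOnLine (STo 2) := by
  let p : STo 2 → ℝ := fun g => ((g : upperTriangularSL 2) : SL(2, ℝ)) 0 0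
  let q : STo 2 → ℝ := fun g => ((g : upperTriangularSL 2) : SL(2, ℝ)) 0 1
  let r : STo 2 → ℝ := fun g => ((g : upperTriangularSL 2) : SL(2, ℝ)) 1 1
  have hpr (g) : p g * r g = 1 := upperTriangularSL_apply_mul _
  have hp0 (g) : 0 < p g := STo_apply_zero_zero_pos g
  have hp (g h) : p (g * h) = p g * p h := by
    have := upperTriangularSL_apply_one_zero h
    simp [p, Matrix.mul_apply, Fin.sum_univ_two, this]
  have hq (g h) : q (g * h) = p g * q h + q g * r h := by
    simp [p, q, r, Matrix.mul_apply, Fin.sum_univ_two]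
  have hp1 : p 1 = 1 := by simp [p]
  have hq1 : q 1 = 0 := by simp [q]
  let act : STo 2 → ℝ → ℝ := fun g x => p g * (p g * x + q g)
  have hact1 (x) : act 1 x = x := by simp [act, hp1, hq1]
  have hact (g h x) : act (g * h) x = act g (act h x) := by
    simp only [act, hp, hq]
    linear_combination (p g * q g) * hpr h
  let φ : STo 2 →* (ℝ ≃o ℝ) :=
    { toFun := fun g =>
        { toFun := act g
          invFun := act g⁻¹
          left_inv := fun x => by rw [← hact, inv_mul_cancel, hact1]
          right_inv := fun x => by rw [← hact, mul_inv_cancel, hact1]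
          map_rel_iff' := by
            intro x y
            simp only [act, Equiv.coe_fn_mk]
            rw [mul_le_mul_iff_right₀ (hp0 g), add_le_add_iff_right, mul_le_mul_iff_right₀ (hp0 g)] }
      map_one' := RelIso.ext hact1
      map_mul' := fun g h => RelIso.ext (hact g h) }
  refine ⟨φ, ?_, fun x => ?_⟩
  · rw [injective_iff_map_eq_one]
    intro g hg
    have h0 : act g 0 = 0 := congrArg (fun e : ℝ ≃o ℝ => e 0) hg
    have h1 : act g 1 = 1 := congrArg (fun e : ℝ ≃o ℝ => e 1) hg
    have hpg := hp0 g
    have hqg : q g = 0 := by simpa [act, hpg.ne'] using h0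
    have hpg1 : p g = 1 := by
      simp only [act, hqg, mul_one, add_zero] at h1
      nlinarith
    have hrg : r g = 1 := by simpa [hpg1] using hpr g
    ext i j
    fin_cases i <;> fin_cases j
    · simpa using hpg1
    · simpa using hqg
    · simpa using upperTriangularSL_apply_one_zero g
    · simpa using hrg
  · have hpc : Continuous p := (continuous_upperTriangularSL_apply 0 0).comp continuous_subtype_val
    have hqc : Continuous q := (continuous_upperTriangularSL_apply 0 1).comp continuous_subtype_val
    exact hpc.mul ((hpc.mul continuous_const).add hqc)

/-! ### The universal covering group of `SL∘(2, ℝ)` -/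

/-- The linear action of `SL(2, ℝ)` on the plane, identified with `ℂ`. -/
def planeAct (A : SL(2, ℝ)) (z : ℂ) : ℂ :=
  ⟨A 0 0 * z.re + A 0 1 * z.im, A 1 0 * z.re + A 1 1 * z.im⟩

theorem planeAct_one (z : ℂ) : planeAct 1 z = z := by
  apply Complex.ext <;> simp [planeAct]

theorem planeAct_mul (A B : SL(2, ℝ)) (z : ℂ) :
    planeAct (A * B) z = planeAct A (planeAct B z) := by
  apply Complex.ext <;> simp [planeAct, Matrix.mul_apply, Fin.sum_univ_two] <;> ring

theorem planeAct_ofReal_mul (A : SL(2, ℝ)) (r : ℝ) (z : ℂ) :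
    planeAct A (r * z) = r * planeAct A z := by
  apply Complex.ext <;> simp [planeAct] <;> ring

theorem planeAct_ne_zero (A : SL(2, ℝ)) {z : ℂ} (hz : z ≠ 0) : planeAct A z ≠ 0 := by
  intro h
  apply hz
  rw [← planeAct_one z, ← inv_mul_cancel A, planeAct_mul, h]
  simp [planeAct, Complex.ext_iff]

theorem continuous_SL_apply {X : Type*} [TopologicalSpace X] {f : X → SL(2, ℝ)}
    (hf : Continuous f) (i j : Fin 2) : Continuous fun x => f x i j :=
  (continuous_apply j).comp (Matrix.SpecialLinearGroup.continuous_apply f hf i)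

theorem Continuous.planeAct {X : Type*} [TopologicalSpace X] {f : X → SL(2, ℝ)} {g : X → ℂ}
    (hf : Continuous f) (hg : Continuous g) : Continuous fun x => planeAct (f x) (g x) := by
  have hre : Continuous fun x => (g x).re := Complex.continuous_re.comp hg
  have him : Continuous fun x => (g x).im := Complex.continuous_im.comp hg
  have h := continuous_SL_apply hf
  refine Complex.equivRealProdCLM.symm.continuous.comp
    (Continuous.prodMk (((h 0 0).mul hre).add ((h 0 1).mul him))
      (((h 1 0).mul hre).add ((h 1 1).mul him)))

/-- The homotopy moving the ray at angle `x` along the path `γ` of matrices, as a family of nonzero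
complex numbers parametrized by the time, the path and the angle. -/
noncomputable def rayHomotopy : C(I × (basedPathGroup (SLo 2) × ℝ), {z : ℂ // z ≠ 0}) where
  toFun p := ⟨planeAct ((p.2.1 : C(I, SLo 2)) p.1) (Complex.exp (p.2.2 * Complex.I)),
    planeAct_ne_zero _ (Complex.exp_ne_zero _)⟩
  continuous_toFun := by
    refine Continuous.subtype_mk (Continuous.planeAct ?_ (by fun_prop)) _
    refine continuous_subtype_val.comp ?_
    exact continuous_eval.comp
      ((continuous_subtype_val.comp (continuous_fst.comp continuous_snd)).prodMk continuous_fst)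

theorem rayHomotopy_zero (a : basedPathGroup (SLo 2) × ℝ) :
    rayHomotopy (0, a) = ⟨_, Complex.exp_ne_zero ((⟨fun a => a.2 * Complex.I, by fun_prop⟩ :
      C(basedPathGroup (SLo 2) × ℝ, ℂ)) a)⟩ := by
  apply Subtype.ext
  have h : (a.1 : C(I, SLo 2)) 0 = 1 := a.1.2
  simp [rayHomotopy, h, planeAct_one]

/-- The continuous complex logarithm of `rayHomotopy` that takes the value `x * I` at time `0`. -/
noncomputable def rayLog : C(I × (basedPathGroup (SLo 2) × ℝ), ℂ) :=
  Complex.isCoveringMap_exp.liftHomotopy rayHomotopy _ rayHomotopy_zero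

theorem exp_rayLog (t : I) (γ : basedPathGroup (SLo 2)) (x : ℝ) :
    Complex.exp (rayLog (t, γ, x)) =
      planeAct ((γ : C(I, SLo 2)) t) (Complex.exp (x * Complex.I)) :=
  congrArg Subtype.val (congrFun (Complex.isCoveringMap_exp.liftHomotopy_lifts rayHomotopy _
    rayHomotopy_zero) (t, γ, x))

theorem rayLog_zero (γ : basedPathGroup (SLo 2)) (x : ℝ) : rayLog (0, γ, x) = x * Complex.I :=
  Complex.isCoveringMap_exp.liftHomotopy_zero _ _ rayHomotopy_zero (γ, x)

/-- The angle at time `t` of the ray that starts at angle `x` and is moved by the path `γ`. -/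
noncomputable def rayAngle (t : I) (γ : basedPathGroup (SLo 2)) (x : ℝ) : ℝ :=
  (rayLog (t, γ, x)).im

theorem Continuous.rayAngle {X : Type*} [TopologicalSpace X] {t : X → I}
    {γ : X → basedPathGroup (SLo 2)} {x : X → ℝ} (ht : Continuous t) (hγ : Continuous γ)
    (hx : Continuous x) : Continuous fun a => rayAngle (t a) (γ a) (x a) :=
  Complex.continuous_im.comp (rayLog.continuous.comp (ht.prodMk (hγ.prodMk hx)))

theorem rayAngle_zero (γ : basedPathGroup (SLo 2)) (x : ℝ) : rayAngle 0 γ x = x := by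
  simp [rayAngle, rayLog_zero]

theorem exists_planeAct_eq_rayAngle (t : I) (γ : basedPathGroup (SLo 2)) (x : ℝ) :
    ∃ r : ℝ, 0 < r ∧ planeAct ((γ : C(I, SLo 2)) t) (Complex.exp (x * Complex.I)) =
      r * Complex.exp (rayAngle t γ x * Complex.I) := by
  refine ⟨_, Real.exp_pos (rayLog (t, γ, x)).re, ?_⟩
  rw [← exp_rayLog, Complex.ofReal_exp, ← Complex.exp_add, rayAngle, Complex.re_add_im]

-- Only the two characterizing equations above are used; unfolding the lift is very slow.
attribute [irreducible] rayLog

theorem circleExp_eq_of_mul_eq {r s a b : ℝ} (hr : 0 < r) (hs : 0 < s)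
    (h : (r : ℂ) * Complex.exp (a * Complex.I) = s * Complex.exp (b * Complex.I)) :
    Circle.exp a = Circle.exp b := by
  have hrs : r = s := by
    simpa [Complex.norm_exp_ofReal_mul_I, abs_of_pos hr, abs_of_pos hs] using congrArg norm h
  subst hrs
  apply Circle.ext
  simpa [hr.ne'] using h

/-- The angle of the moving ray is determined by continuity and its initial value. -/
theorem eq_rayAngle {γ : basedPathGroup (SLo 2)} {x : ℝ} {θ : I → ℝ} (hθ : Continuous θ)
    (h0 : θ 0 = x)
    (h : ∀ t, ∃ r : ℝ, 0 < r ∧ planeAct ((γ : C(I, SLo 2)) t) (Complex.exp (x * Complex.I)) =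
      r * Complex.exp (θ t * Complex.I)) (t : I) : θ t = rayAngle t γ x := by
  have hc : Continuous fun t => rayAngle t γ x :=
    continuous_id.rayAngle continuous_const continuous_const
  refine congrFun (Circle.isCoveringMap_exp.eq_of_comp_eq hθ hc ?_ 0 ?_) t
  · funext s
    obtain ⟨r, hr, hr'⟩ := h s
    obtain ⟨r', hs, hs'⟩ := exists_planeAct_eq_rayAngle s γ x
    exact circleExp_eq_of_mul_eq hr hs (hr'.symm.trans hs')
  · rw [h0, rayAngle_zero]

theorem rayAngle_one (t : I) (x : ℝ) : rayAngle t 1 x = x :=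
  (eq_rayAngle (θ := fun _ => x) continuous_const rfl
    (fun _ => ⟨1, one_pos, by simp [planeAct_one]⟩) t).symm

theorem rayAngle_mul (t : I) (γ η : basedPathGroup (SLo 2)) (x : ℝ) :
    rayAngle t (γ * η) x = rayAngle t γ (rayAngle t η x) := by
  refine (eq_rayAngle (θ := fun t => rayAngle t γ (rayAngle t η x)) ?_ ?_ (fun s => ?_) t).symm
  · exact continuous_id.rayAngle continuous_const
      (continuous_id.rayAngle continuous_const continuous_const)
  · simp only [rayAngle_zero]
  · obtain ⟨r, hr, hr'⟩ := exists_planeAct_eq_rayAngle s η x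
    obtain ⟨q, hq, hq'⟩ := exists_planeAct_eq_rayAngle s γ (rayAngle s η x)
    refine ⟨r * q, mul_pos hr hq, ?_⟩
    simp only [Subgroup.coe_mul, ContinuousMap.mul_apply]
    rw [planeAct_mul, hr', planeAct_ofReal_mul, hq']
    push_cast
    ring

theorem rayAngle_inv_rayAngle (t : I) (γ : basedPathGroup (SLo 2)) (x : ℝ) :
    rayAngle t γ⁻¹ (rayAngle t γ x) = x := by
  rw [← rayAngle_mul, inv_mul_cancel, rayAngle_one]

/-- Rays moved by the same path of matrices never collide, so they keep their order. -/
theorem rayAngle_strictMono (t : I) (γ : basedPathGroup (SLo 2)) :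
    StrictMono (rayAngle t γ) := by
  intro x y hxy
  by_contra! h
  have hc (z : ℝ) : Continuous fun s => rayAngle s γ z :=
    continuous_id.rayAngle continuous_const continuous_const
  obtain ⟨s, hs⟩ := intermediate_value_univ₂ (hc x) (hc y)
    (a := 0) (b := t) (by simpa only [rayAngle_zero] using hxy.le) h
  have := congrArg (rayAngle s γ⁻¹) hs
  rw [rayAngle_inv_rayAngle, rayAngle_inv_rayAngle] at this
  exact hxy.ne this

/-- The action of the based path group on the line of angles: a ray is moved along the path up to
time `1`. -/
noncomputable def pathAngleHom : basedPathGroup (SLo 2) →* (ℝ ≃o ℝ) where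
  toFun γ :=
    { toFun := rayAngle 1 γ
      invFun := rayAngle 1 γ⁻¹
      left_inv := rayAngle_inv_rayAngle 1 γ
      right_inv := fun x => by simpa using rayAngle_inv_rayAngle 1 γ⁻¹ x
      map_rel_iff' := (rayAngle_strictMono 1 γ).le_iff_le }
  map_one' := RelIso.ext (rayAngle_one 1)
  map_mul' γ η := RelIso.ext (rayAngle_mul 1 γ η)

theorem pathAngleHom_apply (γ : basedPathGroup (SLo 2)) (x : ℝ) :
    pathAngleHom γ x = rayAngle 1 γ x := rfl

/-- Along a homotopy relative to the endpoints the final ray is constant, so its angle, which varies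
continuously in a discrete set, is constant too. -/
theorem pathAngleHom_eq_one_of_mem {γ : basedPathGroup (SLo 2)}
    (hγ : γ ∈ nullhomotopicLoops (SLo 2)) : pathAngleHom γ = 1 := by
  obtain ⟨F⟩ := hγ
  have hF0 (s : I) : F (s, 0) = 1 := by
    rw [F.eq_fst s (by simp)]
    exact γ.2
  let p : I → basedPathGroup (SLo 2) := fun s => ⟨F.toHomotopy.toContinuousMap.curry s, hF0 s⟩
  have hp : Continuous p := Continuous.subtype_mk (ContinuousMap.continuous _) _
  have hp0 : p 0 = γ := Subtype.ext (ContinuousMap.ext fun t => F.apply_zero t)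
  have hp1 : p 1 = 1 := Subtype.ext (ContinuousMap.ext fun t => F.apply_one t)
  have hpe (s : I) : (p s : C(I, SLo 2)) 1 = (γ : C(I, SLo 2)) 1 := F.eq_fst s (by simp)
  ext x
  rw [pathAngleHom_apply, RelIso.one_apply]
  refine Eq.trans ?_ (rayAngle_one 1 x)
  rw [← hp0, ← hp1]
  have hc : Continuous fun s => rayLog (1, p s, x) :=
    rayLog.continuous.comp (continuous_const.prodMk (hp.prodMk continuous_const))
  refine congrArg Complex.im (Complex.isCoveringMap_exp.const_of_comp hc (fun s s' => ?_) 0 1)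
  apply Subtype.ext
  simp only [exp_rayLog, hpe]

/-- The matrix of determinant `1` whose first column is `exp w` and whose second column is `s` times
the first plus a vector orthogonal to it. -/
noncomputable def columnMatrix (w : ℂ) (s : ℝ) : SL(2, ℝ) :=
  let z := Complex.exp w
  ⟨!![z.re, s * z.re - z.im / Complex.normSq z; z.im, s * z.im + z.re / Complex.normSq z], by
    have h : Complex.normSq z ≠ 0 := Complex.normSq_eq_zero.not.2 (Complex.exp_ne_zero w)
    rw [Matrix.det_fin_two_of]
    field_simp
    rw [Complex.normSq_apply]
    ring⟩

theorem columnMatrix_zero_zero : columnMatrix 0 0 = 1 := by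
  ext i j
  fin_cases i <;> fin_cases j <;> simp [columnMatrix]

theorem Continuous.columnMatrix {X : Type*} [TopologicalSpace X] {w : X → ℂ} {s : X → ℝ}
    (hw : Continuous w) (hs : Continuous s) : Continuous fun x => columnMatrix (w x) (s x) := by
  have hz : Continuous fun x => Complex.exp (w x) := Complex.continuous_exp.comp hw
  have hre := Complex.continuous_re.comp hz
  have him := Complex.continuous_im.comp hz
  have hn := Complex.continuous_normSq.comp hz
  have h0 (x) : Complex.normSq (Complex.exp (w x)) ≠ 0 :=
    Complex.normSq_eq_zero.not.2 (Complex.exp_ne_zero _)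
  refine Continuous.subtype_mk (continuous_matrix fun i j => ?_) _
  fin_cases i <;> fin_cases j
  · exact hre
  · exact (hs.mul hre).sub (him.div hn h0)
  · exact him
  · exact (hs.mul him).add (hre.div hn h0)

/-- The coefficient of the second column of a matrix along its first column. -/
noncomputable def shear (A : SL(2, ℝ)) : ℝ :=
  (A 0 0 * A 0 1 + A 1 0 * A 1 1) / (A 0 0 ^ 2 + A 1 0 ^ 2)

theorem sq_add_sq_firstColumn_ne_zero (A : SL(2, ℝ)) : A 0 0 ^ 2 + A 1 0 ^ 2 ≠ 0 := by
  intro h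
  have h0 : A 0 0 = 0 := by nlinarith [sq_nonneg (A 0 0), sq_nonneg (A 1 0)]
  have h1 : A 1 0 = 0 := by nlinarith [sq_nonneg (A 0 0), sq_nonneg (A 1 0)]
  have hd := A.det_coe
  rw [Matrix.det_fin_two] at hd
  simp [h0, h1] at hd

theorem shear_one : shear 1 = 0 := by simp [shear]

theorem continuous_shear : Continuous shear := by
  have h := continuous_SL_apply continuous_id
  exact (((h 0 0).mul (h 0 1)).add ((h 1 0).mul (h 1 1))).div (((h 0 0).pow 2).add ((h 1 0).pow 2))
    sq_add_sq_firstColumn_ne_zero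

theorem columnMatrix_shear {A : SL(2, ℝ)} {w : ℂ} (hw : Complex.exp w = planeAct A 1) :
    columnMatrix w (shear A) = A := by
  have hn := sq_add_sq_firstColumn_ne_zero A
  have hd := A.det_coe
  rw [Matrix.det_fin_two] at hd
  have hre : (Complex.exp w).re = A 0 0 := by simp [hw, planeAct]
  have him : (Complex.exp w).im = A 1 0 := by simp [hw, planeAct]
  have hns : Complex.normSq (Complex.exp w) = A 0 0 ^ 2 + A 1 0 ^ 2 := by
    rw [Complex.normSq_apply, hre, him]
    ring
  ext i j
  fin_cases i <;> fin_cases j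
  · simpa [columnMatrix] using hre
  · simp only [columnMatrix, hns, hre, him, shear]
    simp only [Fin.zero_eta, Fin.mk_one, Matrix.of_apply, Matrix.cons_val]
    field_simp
    linear_combination (A 1 0) * hd
  · simpa [columnMatrix] using him
  · simp only [columnMatrix, hns, hre, him, shear]
    simp only [Fin.mk_one, Matrix.of_apply, Matrix.cons_val]
    field_simp
    linear_combination -(A 0 0) * hd

/-- A matrix of determinant `1` that preserves every ray is the identity. -/
theorem eq_one_of_planeAct_exp {A : SL(2, ℝ)} (h : ∀ x : ℝ, ∃ r : ℝ, 0 < r ∧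
    planeAct A (Complex.exp (x * Complex.I)) = r * Complex.exp (x * Complex.I)) : A = 1 := by
  have key (x : ℝ) : ∃ r : ℝ, 0 < r ∧ A 0 0 * Real.cos x + A 0 1 * Real.sin x = r * Real.cos x ∧
      A 1 0 * Real.cos x + A 1 1 * Real.sin x = r * Real.sin x := by
    obtain ⟨r, hr, h⟩ := h x
    have h1 := congrArg Complex.re h
    have h2 := congrArg Complex.im h
    simp only [planeAct, Complex.exp_ofReal_mul_I_re, Complex.exp_ofReal_mul_I_im,
      Complex.re_ofReal_mul, Complex.im_ofReal_mul] at h1 h2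
    exact ⟨r, hr, h1, h2⟩
  obtain ⟨r, hr, h1, h2⟩ := key 0
  obtain ⟨s, hs, h3, h4⟩ := key (Real.pi / 2)
  obtain ⟨q, hq, h5, h6⟩ := key (Real.pi / 4)
  simp only [Real.cos_zero, Real.sin_zero, Real.cos_pi_div_two, Real.sin_pi_div_two, mul_one,
    mul_zero, add_zero, zero_add] at h1 h2 h3 h4
  have hpos : 0 < Real.cos (Real.pi / 4) := by rw [Real.cos_pi_div_four]; positivity
  have hsc : Real.sin (Real.pi / 4) = Real.cos (Real.pi / 4) := by
    rw [Real.cos_pi_div_four, Real.sin_pi_div_four]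
  rw [hsc, h3, zero_mul, add_zero] at h5
  rw [hsc, h2, zero_mul, zero_add] at h6
  have h7 : A 0 0 = A 1 1 := mul_right_cancel₀ hpos.ne' (h5.trans h6.symm)
  have hd := A.det_coe
  rw [Matrix.det_fin_two, h2, h3, ← h7] at hd
  have h8 : A 0 0 = 1 := by nlinarith
  ext i j
  fin_cases i <;> fin_cases j
  · simpa using h8
  · simpa using h3
  · simpa using h2
  · simpa using h7 ▸ h8

/-- If a path of matrices returns every ray to its initial angle, it is a loop whose first column
has a logarithm that is a loop at `0`. Scaling that logarithm and the shear to `0` contracts the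
path. -/
theorem mem_nullhomotopicLoops_of_pathAngleHom {γ : basedPathGroup (SLo 2)}
    (hγ : pathAngleHom γ = 1) : γ ∈ nullhomotopicLoops (SLo 2) := by
  have hang (x : ℝ) : rayAngle 1 γ x = x := congrArg (fun e : ℝ ≃o ℝ => e x) hγ
  have hγ0 : (γ : C(I, SLo 2)) 0 = 1 := γ.2
  have hγ1 : (((γ : C(I, SLo 2)) 1 : SLo 2) : SL(2, ℝ)) = 1 := by
    refine eq_one_of_planeAct_exp fun x => ?_
    simpa only [hang] using exists_planeAct_eq_rayAngle 1 γ x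
  have hexp (t : I) : Complex.exp (rayLog (t, γ, 0)) = planeAct ((γ : C(I, SLo 2)) t) 1 := by
    simpa using exp_rayLog t γ 0
  have hlog0 : rayLog (0, γ, 0) = 0 := by simpa using rayLog_zero γ 0
  have hlog1 : rayLog (1, γ, 0) = 0 := by
    have him : (rayLog (1, γ, 0)).im = 0 := hang 0
    have he := congrArg norm (hexp 1)
    rw [hγ1, planeAct_one, Complex.norm_exp, norm_one, Real.exp_eq_one_iff] at he
    exact Complex.ext he him
  let K : I × I → SL(2, ℝ) := fun p =>
    columnMatrix ((1 - (p.1 : ℝ) : ℝ) * rayLog (p.2, γ, 0))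
      ((1 - (p.1 : ℝ)) * shear ((γ : C(I, SLo 2)) p.2))
  have hK : Continuous K := by
    refine Continuous.columnMatrix ?_ ?_
    · exact (Complex.continuous_ofReal.comp (by fun_prop)).mul
        (rayLog.continuous.comp (continuous_snd.prodMk continuous_const))
    · exact Continuous.mul (by fun_prop) (continuous_shear.comp (continuous_subtype_val.comp
        ((γ : C(I, SLo 2)).continuous.comp continuous_snd)))
  have hK0 (t : I) : K (0, t) = (γ : C(I, SLo 2)) t := by
    simpa [K] using columnMatrix_shear (hexp t)
  have hK1 (t : I) : K (1, t) = 1 := by simpa [K] using columnMatrix_zero_zero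
  have hKl (s : I) : K (s, 0) = 1 := by
    simpa [K, hγ0, hlog0, shear_one] using columnMatrix_zero_zero
  have hKr (s : I) : K (s, 1) = 1 := by
    simpa [K, hγ1, hlog1, shear_one] using columnMatrix_zero_zero
  have hmem (p : I × I) : K p ∈ SLo 2 := by
    have hpre : IsPreconnected (Set.range K) := isPreconnected_range hK
    exact hpre.subset_connectedComponent ⟨(0, 0), hKl 0⟩ ⟨p, rfl⟩
  exact ⟨{ toFun := fun p => ⟨K p, hmem p⟩
           continuous_toFun := hK.subtype_mk hmem
           map_zero_left := fun t => Subtype.ext (hK0 t)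
           map_one_left := fun t => Subtype.ext (hK1 t)
           prop' := fun s t ht => by
             apply Subtype.ext
             rcases ht with rfl | rfl
             · exact (hKl s).trans (congrArg Subtype.val hγ0).symm
             · exact (hKr s).trans hγ1.symm }⟩

theorem actsOnLine_universalCoveringGroup_SLo :
    ActsOnLine (UniversalCoveringGroup (SLo 2)) := by
  refine ⟨QuotientGroup.lift _ pathAngleHom fun γ hγ => pathAngleHom_eq_one_of_mem hγ, ?_,
    fun x => ?_⟩
  · rw [injective_iff_map_eq_one]
    intro q hq
    obtain ⟨γ, rfl⟩ := QuotientGroup.mk_surjective q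
    exact (QuotientGroup.eq_one_iff γ).2 (mem_nullhomotopicLoops_of_pathAngleHom hq)
  · have h : Continuous fun γ : basedPathGroup (SLo 2) => rayAngle 1 γ x :=
      Continuous.rayAngle continuous_const continuous_id continuous_const
    exact QuotientGroup.isOpenQuotientMap_mk.isQuotientMap.continuous_iff.2 h

/-! ### From the line to a manifold -/

/-- The map of a normed space that moves every vector along its ray, its norm being changed by
`f`. -/
noncomputable def radial {E : Type*} [NormedAddCommGroup E] [NormedSpace ℝ E] (f : ℝ → ℝ) (x : E) :
    E :=
  (f ‖x‖ / ‖x‖) • x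

section radial

variable {E : Type*} [NormedAddCommGroup E] [NormedSpace ℝ E]

theorem radial_of_eq {f : ℝ → ℝ} {x : E} (h : f ‖x‖ = ‖x‖) : radial f x = x := by
  rcases eq_or_ne x 0 with rfl | hx
  · simp [radial]
  · rw [radial, h, div_self (norm_ne_zero_iff.2 hx), one_smul]

theorem norm_radial {f : ℝ → ℝ} (hf0 : f 0 = 0) (hf : Monotone f) (x : E) :
    ‖radial f x‖ = f ‖x‖ := by
  rcases eq_or_ne x 0 with rfl | hx
  · simp [radial, hf0]
  · have h : 0 ≤ f ‖x‖ := hf0 ▸ hf (norm_nonneg x)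
    rw [radial, norm_smul, Real.norm_of_nonneg (by positivity),
      div_mul_cancel₀ _ (norm_ne_zero_iff.2 hx)]

theorem radial_comp {f g : ℝ → ℝ} (hg0 : g 0 = 0) (hg : StrictMono g) (x : E) :
    radial (f ∘ g) x = radial f (radial g x) := by
  rcases eq_or_ne x 0 with rfl | hx
  · simp [radial]
  · have h : 0 < ‖x‖ := norm_pos_iff.2 hx
    have h' : 0 < g ‖x‖ := hg0 ▸ hg h
    rw [radial, radial, norm_radial hg0 hg.monotone, radial, smul_smul]
    congr 1
    simp only [Function.comp_apply]
    field_simp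

/-- Continuity at the origin holds because the radial maps are the identity near it. -/
theorem continuous_radial {G : Type*} [TopologicalSpace G] {f : G → ℝ → ℝ}
    (hf : Continuous fun p : G × ℝ => f p.1 p.2) (h1 : ∀ g r, r < 1 → f g r = r) :
    Continuous fun p : G × E => radial (f p.1) p.2 := by
  rw [continuous_iff_continuousAt]
  rintro ⟨g, x⟩
  rcases eq_or_ne x 0 with rfl | hx
  · have hev : (fun p : G × E => radial (f p.1) p.2) =ᶠ[nhds (g, 0)] fun p => p.2 := by
      have : ∀ᶠ p : G × E in nhds (g, 0), ‖p.2‖ < 1 :=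
        (continuous_snd.norm).continuousAt.eventually (gt_mem_nhds (by simp))
      filter_upwards [this] with p hp
      exact radial_of_eq (h1 _ _ hp)
    exact continuousAt_snd.congr hev.symm
  · have hc : Continuous fun p : G × E => f p.1 ‖p.2‖ :=
      hf.comp (continuous_fst.prodMk continuous_snd.norm)
    exact (hc.continuousAt.div continuous_snd.norm.continuousAt (norm_ne_zero_iff.2 hx)).smul
      continuousAt_snd

end radial

/-- A family of maps with the laws of a group action and continuous evaluation is a
`ContinuousAction`, effective if only the identity fixes every point. -/
theorem exists_effective_continuousAction {G M : Type*} [TopologicalSpace G] [Group G]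
    [TopologicalSpace M] (act : G → M → M) (h1 : ∀ x, act 1 x = x)
    (hmul : ∀ g h x, act (g * h) x = act g (act h x))
    (hc : Continuous fun p : G × M => act p.1 p.2) (heff : ∀ g, (∀ x, act g x = x) → g = 1) :
    ∃ α : ContinuousAction G M, α.Effective := by
  have hcg (g) : Continuous (act g) := hc.comp (Continuous.prodMk_right g)
  refine ⟨{ toHom :=
              { toFun := fun g =>
                  { toFun := act g
                    invFun := act g⁻¹
                    left_inv := fun x => by rw [← hmul, inv_mul_cancel, h1]
                    right_inv := fun x => by rw [← hmul, mul_inv_cancel, h1]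
                    continuous_toFun := hcg g
                    continuous_invFun := hcg g⁻¹ }
                map_one' := Homeomorph.ext h1
                map_mul' := fun g h => Homeomorph.ext (hmul g h) }
            continuous_eval := hc }, ?_⟩
  rw [ContinuousAction.Effective, eq_bot_iff]
  intro g hg
  exact heff g fun x => congrArg (fun e : M ≃ₜ M => e x) hg

/-- An action on `X` supported in a compact set extends by the identity along an open embedding of
`X` into a Hausdorff space: the compact support has closed image. -/
theorem exists_effective_continuousAction_of_isOpenEmbedding {G X M : Type*} [TopologicalSpace G]
    [Group G] [TopologicalSpace X] [TopologicalSpace M] [T2Space M] {ι : X → M}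
    (hι : Topology.IsOpenEmbedding ι) (act : G → X → X) (h1 : ∀ x, act 1 x = x)
    (hmul : ∀ g h x, act (g * h) x = act g (act h x))
    (hc : Continuous fun p : G × X => act p.1 p.2) (heff : ∀ g, (∀ x, act g x = x) → g = 1)
    {K : Set X} (hK : IsCompact K) (hsupp : ∀ g, ∀ x ∉ K, act g x = x) :
    ∃ α : ContinuousAction G M, α.Effective := by
  let ext : G → M → M := fun g => Function.extend ι (ι ∘ act g) id
  have hext (g x) : ext g (ι x) = ι (act g x) := hι.injective.extend_apply _ _ x
  have hext' (g) {y} (hy : y ∉ Set.range ι) : ext g y = y :=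
    Function.extend_apply' _ _ _ fun ⟨x, hx⟩ => hy ⟨x, hx⟩
  have hextK (g) {y} (hy : y ∉ ι '' K) : ext g y = y := by
    by_cases hr : y ∈ Set.range ι
    · obtain ⟨x, rfl⟩ := hr
      rw [hext, hsupp g x fun hx => hy ⟨x, hx, rfl⟩]
    · exact hext' g hr
  refine exists_effective_continuousAction ext ?_ ?_ ?_ ?_
  · intro y
    by_cases hr : y ∈ Set.range ι
    · obtain ⟨x, rfl⟩ := hr
      rw [hext, h1]
    · exact hext' 1 hr
  · intro g h y
    by_cases hr : y ∈ Set.range ι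
    · obtain ⟨x, rfl⟩ := hr
      simp only [hext, hmul]
    · simp only [hext' _ hr]
  · rw [continuous_iff_continuousAt]
    rintro ⟨g, y⟩
    by_cases hr : y ∈ Set.range ι
    · obtain ⟨x, rfl⟩ := hr
      have ho : Topology.IsOpenEmbedding (Prod.map id ι : G × X → G × M) :=
        Topology.IsOpenEmbedding.id.prodMap hι
      rw [show (g, ι x) = Prod.map id ι (g, x) from rfl, ← ho.continuousAt_iff]
      refine Continuous.continuousAt ?_
      simpa only [Function.comp_def, Prod.map, id, hext] using hι.continuous.comp hc
    · have hopen : IsOpen (ι '' K)ᶜ := (hK.image hι.continuous).isClosed.isOpen_compl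
      have hy : y ∈ (ι '' K)ᶜ := fun ⟨x, _, hx⟩ => hr ⟨x, hx⟩
      have hev : (fun p : G × M => ext p.1 p.2) =ᶠ[nhds (g, y)] fun p => p.2 := by
        filter_upwards [continuousAt_snd.eventually (hopen.mem_nhds hy)] with p hp
        exact hextK p.1 hp
      exact continuousAt_snd.congr hev.symm
  · intro g hg
    exact heff g fun x => hι.injective (by rw [← hext, hg])

/-- A nonempty manifold, with or without boundary, contains an open copy of its model vector
space. -/
theorem exists_isOpenEmbedding_model {E : Type*} [NormedAddCommGroup E] [NormedSpace ℝ E]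
    {H : Type*} [TopologicalSpace H] (J : ModelWithCorners ℝ E H) (M : Type*) [TopologicalSpace M]
    [Nonempty M] [ChartedSpace H M] : ∃ ι : E → M, Topology.IsOpenEmbedding ι := by
  obtain ⟨x⟩ := ‹Nonempty M›
  obtain ⟨c, hc⟩ := interior_extChartAt_target_nonempty J x
  obtain ⟨r, hr, hball⟩ := Metric.isOpen_iff.1 isOpen_interior c hc
  have hball' : Metric.ball c r ⊆ (extChartAt J x).target := hball.trans interior_subset
  let u := OpenPartialHomeomorph.univBall c r
  have hu (v) : u v ∈ Metric.ball c r := by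
    rw [← OpenPartialHomeomorph.univBall_target c hr]
    exact u.map_source (by simp [u])
  have huc : Continuous u := OpenPartialHomeomorph.continuous_univBall c r
  have hcont : Continuous fun v => (extChartAt J x).symm (u v) :=
    (continuousOn_extChartAt_symm x).comp_continuous huc fun v => hball' (hu v)
  refine ⟨fun v => (extChartAt J x).symm (u v), .of_continuous_injective_isOpenMap hcont ?_ ?_⟩
  · intro v w hvw
    have := (extChartAt J x).symm.injOn (hball' (hu v)) (hball' (hu w)) hvw
    exact u.injOn (by simp [u]) (by simp [u]) this
  · intro s hs
    have hus : IsOpen (u '' s) := u.isOpen_image_of_subset_source hs (by simp [u])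
    have himg : (fun v => (extChartAt J x).symm (u v)) '' s =
        (extChartAt J x).source ∩ extChartAt J x ⁻¹' (u '' s) := by
      rw [← (extChartAt J x).symm_image_eq_source_inter_preimage, Set.image_image]
      rintro _ ⟨v, _, rfl⟩
      exact hball' (hu v)
    rw [himg]
    exact (continuousOn_extChartAt x).isOpen_inter_preimage (isOpen_extChartAt_source x) hus

/-- A group acting on the line acts on the norms in the model vector space, moving only norms
between `1` and `3`, and hence on the manifold. -/
theorem ActsOnLine.exists_effective_continuousAction_manifold {G : Type*} [TopologicalSpace G]
    [Group G] (hG : ActsOnLine G)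
    {E : Type*} [NormedAddCommGroup E] [NormedSpace ℝ E] [FiniteDimensional ℝ E] [Nontrivial E]
    {H : Type*} [TopologicalSpace H] (J : ModelWithCorners ℝ E H)
    (M : Type*) [TopologicalSpace M] [T2Space M] [Nonempty M] [ChartedSpace H M] :
    ∃ α : ContinuousAction G M, α.Effective := by
  obtain ⟨φ, hφ, hc⟩ := hG
  obtain ⟨ι, hι⟩ := exists_isOpenEmbedding_model J M
  have hψ {r : ℝ} (hr : r ∉ Set.Ioo (1 : ℝ) 3) (g : G) : shiftedSqueeze (φ g) r = r :=
    shiftedSqueeze_of_notMem _ hr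
  have hψ0 (g : G) : shiftedSqueeze (φ g) 0 = 0 := hψ (by norm_num) g
  have : ProperSpace E := FiniteDimensional.proper_real E
  refine exists_effective_continuousAction_of_isOpenEmbedding hι
    (fun g => radial (shiftedSqueeze (φ g))) (fun x => ?_) (fun g h x => ?_) ?_ (fun g hg => ?_)
    (isCompact_closedBall (0 : E) 3) (fun g x hx => ?_)
  · exact radial_of_eq (by simp)
  · rw [← radial_comp (hψ0 h) (shiftedSqueeze (φ h)).strictMono, map_mul, map_mul, RelIso.coe_mul]
  · exact continuous_radial (continuous_uncurry_orderIso (continuous_shiftedSqueeze_apply hc))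
      fun g r hr => hψ (fun h => by linarith [h.1]) g
  · apply hφ
    apply shiftedSqueeze_injective
    ext r
    rw [map_one, map_one, RelIso.one_apply]
    by_cases hr : r ∈ Set.Ioo (1 : ℝ) 3
    · obtain ⟨v, hv⟩ := exists_norm_eq E (show (0 : ℝ) ≤ r by linarith [hr.1])
      have := congrArg norm (hg v)
      rwa [norm_radial (hψ0 g) (shiftedSqueeze (φ g)).monotone, hv] at this
    · exact hψ hr g
  · refine radial_of_eq (hψ (fun h => hx ?_) g)
    simpa using h.2.le

theorem mainTheorem11 (j k m : ℕ)
    {E : Type*} [NormedAddCommGroup E] [NormedSpace ℝ E] [FiniteDimensional ℝ E]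
    (hE : 0 < Module.finrank ℝ E)
    {H : Type*} [TopologicalSpace H] (J : ModelWithCorners ℝ E H)
    {M : Type*} [TopologicalSpace M] [T2Space M] [Nonempty M] [ChartedSpace H M]
    [IsManifold J 0 M] :
    ∃ α : ContinuousAction
        ((Fin j → UniversalCoveringGroup (SLo 2)) × (Fin k → STo 2) ×
          Multiplicative (Fin m → ℝ)) M,
      α.Effective := by
  have : Nontrivial E := Module.nontrivial_of_finrank_pos hE
  exact ((actsOnLine_universalCoveringGroup_SLo.pi j).prod ((actsOnLine_STo.pi k).prod
    (actsOnLine_multiplicative_pi m))).exists_effective_continuousAction_manifold J M
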